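/- Let $G$ be a compact connected Lie group with Lie algebra $\mathfrak g$, let $\eta\in\mathfrak g^*$, and let $\mathcal O=\{\mathrm{Ad}^*(g)\eta : g\in G\}\subset\mathfrak g^*$ be its coadjoint orbit, endowed with the standard symplectic form $\omega_\nu(\mathrm{ad}^*_X\nu,\mathrm{ad}^*_Y\nu)=\langle\nu,[X,Y]\rangle$. Let $\mathrm{Ham}(\mathcal O)$ be the group of Hamiltonian diffeomorphisms of $(\mathcal O,\omega)$ (the time-one maps of Hamiltonian isotopies generated by smooth time-dependent Hamiltonians), with the $C^\infty$ topology. Let $H$ be a maximal torus of $G$ contained in the stabilizer of $\eta$, with Lie algebra $\mathfrak h$, and let $W=N(H)/H$ be the Weyl group of $(G,H)$, acting on $\mathfrak h$ through $\mathrm{Ad}$. A Hamiltonian circle action on $\mathcal O$ is a group homomorphism $\psi:U(1)\to\mathrm{Ham}(\mathcal O)$ whose action map $U(1)\times\mathcal O\to\mathcal O$ is smooth. Two such actions $\psi,\psi'$ are called $\sim$-equivalent if there is a family $\{\psi^s\}_{s\in[0,1]}$ of Hamiltonian circle actions with $\psi^0=\psi$ and $\psi^1=\psi'$ such that $(s,z)\mapsto\psi^s_z$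 is a continuous map $[0,1]\times U(1)\to\mathrm{Ham}(\mathcal O)$. Let $X,X'$ be elements of the integer lattice $\{Y\in\mathfrak h : \exp Y=1\}$ of $\mathfrak h$. Then $\psi_{e^{2\pi i t}}(\nu)=\mathrm{Ad}^*(\exp(tX))\nu$ and $\psi'_{e^{2\pi i t}}(\nu)=\mathrm{Ad}^*(\exp(tX'))\nu$ define Hamiltonian circle actions on $\mathcal O$, and if there exists $w\in W$ with $w(X)=X'$, then $\psi$ and $\psi'$ are $\sim$-equivalent. -/

import Mathlib

open scoped Manifold ContDiff

noncomputable section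

/-! ## Lie algebra, adjoint and coadjoint representation

Throughout, `G` is a (finite-dimensional, real) Lie group modelled on the vector space `E`.
The Lie algebra of `G` is the tangent space at the identity, Mathlib's
`GroupLieAlgebra 𝓘(ℝ, E) G`, whose underlying vector space is by definition the model space `E`.
It is written `E` below, so that the dual of the Lie algebra is the normed space `E →L[ℝ] ℝ`.
-/

section Coadjoint

instance instLEInftyMinSmoothnessThree : ENat.LEInfty (minSmoothness ℝ 3) :=
  ⟨by
    rw [minSmoothness_of_isRCLikeNormedField]
    exact ENat.LEInfty.out⟩

variable {E : Type*} [NormedAddCommGroup E] [NormedSpace ℝ E]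
variable (G : Type*) [TopologicalSpace G] [ChartedSpace E G] [Group G]

/-- The Lie bracket of the Lie algebra of `G` (the bracket of left-invariant vector fields). -/
def lieBr (X Y : E) : E :=
  @Bracket.bracket (GroupLieAlgebra 𝓘(ℝ, E) G) (GroupLieAlgebra 𝓘(ℝ, E) G) _ X Y

/-- `ad X = [X, ·]` as a continuous linear endomorphism of the Lie algebra. -/
def lieAd [FiniteDimensional ℝ E] [LieGroup 𝓘(ℝ, E) ∞ G] (X : E) : E →L[ℝ] E :=
  haveI : CompleteSpace E := FiniteDimensional.complete ℝ E
  LinearMap.toContinuousLinearMap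
    { toFun := fun Y => lieBr G X Y
      map_add' := fun Y Z =>
        lie_add (L := GroupLieAlgebra 𝓘(ℝ, E) G) (M := GroupLieAlgebra 𝓘(ℝ, E) G) X Y Z
      map_smul' := fun c Y =>
        lie_smul (R := ℝ) (L := GroupLieAlgebra 𝓘(ℝ, E) G) (M := GroupLieAlgebra 𝓘(ℝ, E) G)
          c X Y }

variable {G}

/-- The adjoint representation: `Ad g` is the differential at `1` of `x ↦ g x g⁻¹`. -/
def lieAdj (g : G) : E →L[ℝ] E :=
  mfderiv 𝓘(ℝ, E) 𝓘(ℝ, E) (fun x : G => g * x * g⁻¹) 1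

/-- The coadjoint representation: `⟨Ad*(g) ν, Y⟩ = ⟨ν, Ad(g⁻¹) Y⟩`. -/
def coAd (g : G) (ν : E →L[ℝ] ℝ) : E →L[ℝ] ℝ := ν.comp (lieAdj g⁻¹)

theorem lieAdj_mul [LieGroup 𝓘(ℝ, E) ∞ G] (g h : G) :
    (lieAdj (g * h) : E →L[ℝ] E) = (lieAdj g).comp (lieAdj h) := by
  have hd : ∀ a : G, MDifferentiable 𝓘(ℝ, E) 𝓘(ℝ, E) (fun x : G => a * x * a⁻¹) := fun a =>
    ((contMDiff_mul_right (I := 𝓘(ℝ, E)) (n := ∞) (a := a⁻¹)).comp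
      (contMDiff_mul_left (I := 𝓘(ℝ, E)) (n := ∞) (a := a))).mdifferentiable (by simp)
  have h1 : (fun x : G => (g * h) * x * (g * h)⁻¹)
      = (fun x : G => g * x * g⁻¹) ∘ (fun x : G => h * x * h⁻¹) := by
    funext x
    simp [mul_assoc]
  have h2 : h * 1 * h⁻¹ = 1 := by simp
  have h3 := mfderiv_comp (I := 𝓘(ℝ, E)) (I' := 𝓘(ℝ, E)) (I'' := 𝓘(ℝ, E)) (1 : G)
    (g := fun x : G => g * x * g⁻¹) (f := fun x : G => h * x * h⁻¹)
    ((hd g) _) ((hd h) _)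
  unfold lieAdj
  rw [h1]
  refine h3.trans ?_
  rw [h2]
  rfl

theorem coAd_mul [LieGroup 𝓘(ℝ, E) ∞ G] (g h : G) (ν : E →L[ℝ] ℝ) :
    coAd (g * h) ν = coAd g (coAd h ν) := by
  simp only [coAd, mul_inv_rev, lieAdj_mul]
  rfl

/-! ## Exponential map -/

/-- `γ` is the one-parameter subgroup of `G` with initial velocity `X`. -/
structure IsOneParam (X : E) (γ : ℝ → G) : Prop where
  map_add : ∀ s t : ℝ, γ (s + t) = γ s * γ t
  hasMFDerivAt : HasMFDerivAt 𝓘(ℝ, ℝ) 𝓘(ℝ, E) γ 0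
    (ContinuousLinearMap.toSpanSingleton ℝ X : ℝ →L[ℝ] E)

open Classical in
/-- The exponential map: `exp X = γ 1`, where `γ` is the one-parameter subgroup with initial
velocity `X`. (On a Lie group `γ` exists and is unique, so the default value is never used.) -/
def lieExp (G : Type*) [TopologicalSpace G] [ChartedSpace E G] [Group G] (X : E) : G :=
  if h : ∃ γ : ℝ → G, IsOneParam X γ then h.choose 1 else 1

/-! ## Maximal tori, integer lattice, Weyl group -/

/-- A subgroup that is a torus, i.e. isomorphic as a topological group to `U(1)ⁿ`, `n ≥ 0`. -/
def IsTorusSubgroup (H : Subgroup G) : Prop :=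
  ∃ n : ℕ, Nonempty (H ≃ₜ* (Fin n → Circle))

/-- A maximal torus of `G`. -/
def IsMaximalTorus (H : Subgroup G) : Prop :=
  IsTorusSubgroup H ∧ ∀ K : Subgroup G, IsTorusSubgroup K → H ≤ K → K = H

/-- The Lie algebra of the (closed) subgroup `H`: those `X` with `exp (t X) ∈ H` for all `t`. -/
def lieOf (H : Subgroup G) : Set E := {X | ∀ t : ℝ, lieExp G (t • X) ∈ H}

/-- The integer lattice of the Lie algebra of the torus `H`: the kernel of its exponential map. -/
def integerLattice (H : Subgroup G) : Set E := {X | X ∈ lieOf H ∧ lieExp G X = 1}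

/-- The Weyl group `N(H)/H` of the pair `(G, H)`. -/
abbrev WeylGroup (H : Subgroup G) : Type _ :=
  (Subgroup.normalizer (H : Set G)) ⧸ H.subgroupOf (Subgroup.normalizer (H : Set G))

/-- `w(X) = X'` for the action of the Weyl group on the Lie algebra of `H`: the class `w = n H`
acts through `Ad n`. (For a torus `H` and `X` in its Lie algebra, `Ad n X` is independent of the
representative `n`, since `H` is commutative.) -/
def WeylSends {H : Subgroup G} (w : WeylGroup H) (X X' : E) : Prop :=
  ∃ n : Subgroup.normalizer (H : Set G), (QuotientGroup.mk n : WeylGroup H) = w ∧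
    lieAdj (n : G) X = X'

/-! ## Coadjoint orbits -/

variable (G)

/-- The coadjoint orbit of `η`, a compact submanifold of the dual of the Lie algebra. -/
def CoadjointOrbit (η : E →L[ℝ] ℝ) : Type _ :=
  {ν : E →L[ℝ] ℝ // ∃ g : G, coAd g η = ν}

variable {G}
variable {η : E →L[ℝ] ℝ}

namespace CoadjointOrbit

/-- A point of the orbit as an element of the dual of the Lie algebra. -/
def val (ν : CoadjointOrbit G η) : E →L[ℝ] ℝ := Subtype.val ν

/-- The action of `G` on the coadjoint orbit. -/
def act [LieGroup 𝓘(ℝ, E) ∞ G] (g : G) (ν : CoadjointOrbit G η) : CoadjointOrbit G η :=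
  ⟨coAd g ν.val, by
    obtain ⟨ν, a, rfl⟩ := ν
    exact ⟨g * a, coAd_mul g a η⟩⟩

end CoadjointOrbit

/-- A map from the orbit to a normed space is smooth. As the orbit is a closed embedded
submanifold of the dual of the Lie algebra, this means that it is the restriction of a smooth map
on that vector space. -/
def SmoothOnOrbit {W : Type*} [NormedAddCommGroup W] [NormedSpace ℝ W]
    (f : CoadjointOrbit G η → W) : Prop :=
  ∃ F : (E →L[ℝ] ℝ) → W, ContDiff ℝ ∞ F ∧ ∀ ν : CoadjointOrbit G η, F ν.val = f ν

/-- A map from `ℝ × 𝒪` to a normed space is smooth: it is the restriction of a smooth map on the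
vector space in which `ℝ × 𝒪` is a closed embedded submanifold. -/
def SmoothFamilyOnOrbit {W : Type*} [NormedAddCommGroup W] [NormedSpace ℝ W]
    (f : ℝ → CoadjointOrbit G η → W) : Prop :=
  ∃ F : ℝ × (E →L[ℝ] ℝ) → W, ContDiff ℝ ∞ F ∧
    ∀ (t : ℝ) (ν : CoadjointOrbit G η), F (t, ν.val) = f t ν

/-- The derivative of a function on the orbit along the fundamental vector field of `X`,
`(L_X f)(ν) = d/dt f(exp(tX) · ν)` at `t = 0`. -/
def orbitDeriv [LieGroup 𝓘(ℝ, E) ∞ G] {W : Type*} [NormedAddCommGroup W] [NormedSpace ℝ W]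
    (X : E) (f : CoadjointOrbit G η → W) (ν : CoadjointOrbit G η) : W :=
  deriv (fun t : ℝ => f (CoadjointOrbit.act (lieExp G (t • X)) ν)) 0

/-- The iterated derivative `L_{X₁} ⋯ L_{Xₖ} f` along fundamental vector fields. -/
def orbitIterDeriv [LieGroup 𝓘(ℝ, E) ∞ G] {W : Type*} [NormedAddCommGroup W] [NormedSpace ℝ W]
    (l : List E) (f : CoadjointOrbit G η → W) : CoadjointOrbit G η → W :=
  l.foldr (fun X u => orbitDeriv X u) f

/-! ## The standard (Kirillov–Kostant–Souriau) symplectic structure -/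

section Symplectic

variable [FiniteDimensional ℝ E] [LieGroup 𝓘(ℝ, E) ∞ G]

variable (G) in
/-- The infinitesimal coadjoint action: `⟨ad*_X ν, Y⟩ = -⟨ν, [X, Y]⟩`. -/
def coadInf (X : E) (ν : E →L[ℝ] ℝ) : E →L[ℝ] ℝ := -(ν.comp (lieAd G X))

theorem coadInf_apply (X Y : E) (ν : E →L[ℝ] ℝ) : coadInf G X ν Y = -ν (lieBr G X Y) := rfl

variable (G) in
/-- The tangent space at `ν` of the coadjoint orbit through `ν`, as a subset of the dual of the
Lie algebra: all vectors `ad*_X ν`. -/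
def orbitTangent (ν : E →L[ℝ] ℝ) : Set (E →L[ℝ] ℝ) := Set.range (fun X : E => coadInf G X ν)

variable (G) in
/-- The standard symplectic form on tangent vectors of the orbit at `ν`:
`ω_ν (ad*_X ν, ad*_Y ν) = ⟨ν, [X, Y]⟩`; see `kksForm_coadInf` for independence of choices. -/
def kksForm (ν : E →L[ℝ] ℝ) (v w : orbitTangent G ν) : ℝ :=
  ν (lieBr G v.2.choose w.2.choose)

theorem kksForm_coadInf (ν : E →L[ℝ] ℝ) (X Y : E) :
    kksForm G ν ⟨coadInf G X ν, X, rfl⟩ ⟨coadInf G Y ν, Y, rfl⟩ = ν (lieBr G X Y) := by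
  have : CompleteSpace E := FiniteDimensional.complete ℝ E
  have skew : ∀ A B : E, ν (lieBr G A B) = -ν (lieBr G B A) := fun A B => by
    have h : lieBr G A B = -lieBr G B A :=
      (lie_skew (L := GroupLieAlgebra 𝓘(ℝ, E) G) A B).symm
    rw [h, map_neg]
  have key : ∀ (A B : E), coadInf G A ν = coadInf G B ν →
      ∀ Z, ν (lieBr G A Z) = ν (lieBr G B Z) := fun A B h Z => by
    have := congrArg (fun u : E →L[ℝ] ℝ => u Z) h
    simpa [coadInf_apply] using this
  have hX : ∃ A, coadInf G A ν = coadInf G X ν := ⟨X, rfl⟩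
  have hY : ∃ A, coadInf G A ν = coadInf G Y ν := ⟨Y, rfl⟩
  change ν (lieBr G hX.choose hY.choose) = _
  rw [key _ _ hX.choose_spec, skew, key _ _ hY.choose_spec, ← skew]

/-- `v` is the value at `ν` of the Hamiltonian vector field of the function `h` on the orbit:
`v` is tangent to the orbit and `ω_ν (v, ·) = dh_ν` on all tangent vectors `ad*_Y ν`. -/
def IsHamiltonianVector (h : CoadjointOrbit G η → ℝ) (ν : CoadjointOrbit G η)
    (v : E →L[ℝ] ℝ) : Prop :=
  ∃ hv : v ∈ orbitTangent G ν.val, ∀ Y : E,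
    kksForm G ν.val ⟨v, hv⟩ ⟨coadInf G Y ν.val, Y, rfl⟩ = orbitDeriv Y h ν

end Symplectic

/-! ## Diffeomorphisms of the orbit and the `C^∞` topology -/

variable (G η) in
/-- The group of diffeomorphisms of the orbit, as a subgroup of its permutations. -/
def orbitDiffeoSubgroup : Subgroup (Equiv.Perm (CoadjointOrbit G η)) where
  carrier := {f | SmoothOnOrbit (fun ν => (f ν).val) ∧ SmoothOnOrbit (fun ν => (f⁻¹ ν).val)}
  one_mem' := ⟨⟨id, contDiff_id, fun _ => rfl⟩, ⟨id, contDiff_id, fun _ => rfl⟩⟩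
  mul_mem' := by
    rintro f g ⟨⟨F, hF, hF'⟩, ⟨F1, hF1, hF1'⟩⟩ ⟨⟨K, hK, hK'⟩, ⟨K1, hK1, hK1'⟩⟩
    refine ⟨⟨F ∘ K, hF.comp hK, fun ν => ?_⟩, ⟨K1 ∘ F1, hK1.comp hF1, fun ν => ?_⟩⟩
    · simp only [Function.comp_apply, hK', hF', Equiv.Perm.mul_apply]
    · simp only [Function.comp_apply, hF1', hK1', mul_inv_rev, Equiv.Perm.mul_apply]
  inv_mem' := by
    rintro f ⟨hf, hf'⟩
    exact ⟨hf', by simpa using hf⟩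

variable (G η) in
/-- The group `Diff(𝒪)` of diffeomorphisms of the orbit. -/
def OrbitDiffeo : Type _ := orbitDiffeoSubgroup G η

instance instGroupOrbitDiffeo : Group (OrbitDiffeo G η) :=
  inferInstanceAs (Group (orbitDiffeoSubgroup G η))

namespace OrbitDiffeo

/-- Evaluation of a diffeomorphism of the orbit. -/
def app (f : OrbitDiffeo G η) (ν : CoadjointOrbit G η) : CoadjointOrbit G η :=
  (Subtype.val f : Equiv.Perm (CoadjointOrbit G η)) ν

theorem one_app (ν : CoadjointOrbit G η) : (1 : OrbitDiffeo G η).app ν = ν := rfl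

theorem mul_app (f g : OrbitDiffeo G η) (ν : CoadjointOrbit G η) :
    (f * g).app ν = f.app (g.app ν) := rfl

end OrbitDiffeo

/-- The `C^∞` topology on `Diff(𝒪)`: uniform convergence on the (compact) orbit of all iterated
derivatives `L_{X₁} ⋯ L_{Xₖ} f`, `k ≥ 0`, along fundamental vector fields; these vector fields span
every tangent space of the orbit. -/
instance instTopologicalSpaceOrbitDiffeo [LieGroup 𝓘(ℝ, E) ∞ G] :
    TopologicalSpace (OrbitDiffeo G η) :=
  ⨅ l : List E, TopologicalSpace.induced
    (fun f : OrbitDiffeo G η => UniformFun.ofFun (orbitIterDeriv l (fun ν => (f.app ν).val)))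
    (inferInstance : TopologicalSpace (UniformFun (CoadjointOrbit G η) (E →L[ℝ] ℝ)))

/-! ## Hamiltonian diffeomorphisms and Hamiltonian circle actions -/

section Hamiltonian

variable [FiniteDimensional ℝ E] [LieGroup 𝓘(ℝ, E) ∞ G]

variable (G η) in
/-- The Hamiltonian group `Ham(𝒪) ⊆ Diff(𝒪)`: the time-one maps of the Hamiltonian isotopies
`φ_t`, `φ_0 = id`, generated by smooth time-dependent Hamiltonians `h_t`. -/
def orbitHam : Set (OrbitDiffeo G η) :=
  {f | ∃ (h : ℝ → CoadjointOrbit G η → ℝ) (φ : ℝ → OrbitDiffeo G η),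
    SmoothFamilyOnOrbit h ∧ SmoothFamilyOnOrbit (fun t ν => ((φ t).app ν).val) ∧
    φ 0 = 1 ∧ φ 1 = f ∧
    ∀ (t : ℝ) (ν : CoadjointOrbit G η), ∃ v : E →L[ℝ] ℝ,
      IsHamiltonianVector (h t) ((φ t).app ν) v ∧
      HasDerivAt (fun s : ℝ => ((φ s).app ν).val) v t}

variable (G η) in
/-- A Hamiltonian circle action on the orbit, i.e. a Lie group homomorphism `U(1) → Ham(𝒪)`:
a group homomorphism with values in `Ham(𝒪)` for which the action map `U(1) × 𝒪 → 𝒪` is smooth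
(expressed through the covering `t ↦ e^{it}` of `U(1)`). -/
structure HamCircleAction where
  /-- The underlying homomorphism. -/
  hom : Circle →* OrbitDiffeo G η
  mem_ham : ∀ z : Circle, hom z ∈ orbitHam G η
  smooth : SmoothFamilyOnOrbit (fun (t : ℝ) ν => ((hom (Circle.exp t)).app ν).val)

/-- The circle action generated by `X` (with `exp X = 1`): `e^{2πit}` acts by `exp (tX)`. -/
def HamCircleAction.IsGeneratedBy (ψ : HamCircleAction G η) (X : E) : Prop :=
  ∀ (t : ℝ) (ν : CoadjointOrbit G η),
    (ψ.hom (Circle.exp (2 * Real.pi * t))).app ν = CoadjointOrbit.act (lieExp G (t • X)) ν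

/-- `ψ ∼ ψ'`: there is a family `ψ^s`, `s ∈ [0,1]`, of Lie group homomorphisms `U(1) → Ham(𝒪)`
from `ψ` to `ψ'` that is continuous for the `C^∞` topology. -/
def HamCircleAction.Homotopic (ψ ψ' : HamCircleAction G η) : Prop :=
  ∃ Ψ : unitInterval → HamCircleAction G η, Ψ 0 = ψ ∧ Ψ 1 = ψ' ∧
    Continuous (fun p : unitInterval × Circle => (Ψ p.1).hom p.2)

end Hamiltonian

end Coadjoint

end

/-!
The group `G` is connected, so a representative `n` of the Weyl group element is joined to `1` by a
path `g_s` in `G`. Put `X_s = Ad(g_s) X`. Since `exp X_s = g_s (exp X) g_s⁻¹ = 1`, every `X_s`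
generates a circle action `ψ^s`, namely `ψ^s_{e^{2πit}} = Ad*(g_s (exp tX) g_s⁻¹)`, and `ψ^s` runs
from the action of `X` to that of `Ad(n) X = X'`; see `exists_homotopic_of_lieAdj`.

What has to be known for this to be a homotopy of Hamiltonian circle actions:

* One-parameter subgroups exist and are unique (`exists_isOneParam`, `IsOneParam.unique`): they are
  the integral curves through `1` of left-invariant vector fields, which are complete because
  translations carry integral curves to integral curves.
* The flow `Ad*(exp tX)` on the orbit is the Hamiltonian flow of `ν ↦ ⟨ν, X⟩`
  (`actHom_lieExp_mem_orbitHam`). This rests on `d/dt Ad(exp tX) = ad X` at `t = 0`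
  (`IsOneParam.hasDerivAt_lieAdj_zero`), where `ad X` is defined by the bracket of left-invariant
  vector fields. In a chart it follows from `d L_g = d R_g ∘ Ad g` and the symmetry of the second
  derivative of the multiplication (`fderiv_adjoint_eq_lieBracket`).
* The homomorphism from `G` to the diffeomorphisms of the orbit is continuous for the `C^∞` topology
  (`continuous_actHom`). The diffeomorphism `Ad*(g)` is linear, so its iterated derivatives along
  fundamental vector fields are `Ad*(g) ∘ A` with a linear map `A` independent of `g`; it remains
  that `Ad*` is continuous in the operator norm and that the orbit is bounded.
-/

open scoped Manifold ContDiff Topology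

noncomputable section

/-! ### Linear differential equations and uniform convergence in normed spaces -/

section NormedSpaces

variable {F F' : Type*} [NormedAddCommGroup F] [NormedSpace ℝ F] [NormedAddCommGroup F']
  [NormedSpace ℝ F']

theorem ContinuousLinearMap.hasDerivAt_comp (T : F →L[ℝ] F') {a : ℝ → F} {a' : F} {t : ℝ}
    (h : HasDerivAt a a' t) : HasDerivAt (fun s => T (a s)) (T a') t :=
  T.hasFDerivAt.comp_hasDerivAt t h

/-- A one-parameter group of operators solves the differential equation given by its derivative
at `0`. -/
theorem hasDerivAt_of_map_add {u : ℝ → F →L[ℝ] F} {B : F →L[ℝ] F}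
    (hu : ∀ s t, u (s + t) = (u s).comp (u t)) (h0 : HasDerivAt u B 0) (t : ℝ) :
    HasDerivAt u (B.comp (u t)) t := by
  have h1 : HasDerivAt u B (t - t) := by rwa [sub_self]
  have h2 := (h1.comp_sub_const t t).clm_comp (hasDerivAt_const t (u t))
  simp only [ContinuousLinearMap.comp_zero, add_zero] at h2
  refine h2.congr_of_eventuallyEq (Filter.Eventually.of_forall fun s => ?_)
  change u s = (u (s - t)).comp (u t)
  rw [← hu, sub_add_cancel]

/-- The equation `u' = B ∘ u` raises the order of differentiability of `u` by one. -/
theorem contDiff_of_hasDerivAt_comp {u : ℝ → F →L[ℝ] F} {B : F →L[ℝ] F}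
    (h : ∀ t, HasDerivAt u (B.comp (u t)) t) : ContDiff ℝ ∞ u := by
  rw [contDiff_infty]
  intro n
  induction n with
  | zero => exact contDiff_zero.2 (continuous_iff_continuousAt.2 fun t => (h t).continuousAt)
  | succ n ih =>
    rw [Nat.cast_add, Nat.cast_one, contDiff_succ_iff_deriv]
    refine ⟨fun t => (h t).differentiableAt, by simp, ?_⟩
    rw [show deriv u = fun t => B.comp (u t) from funext fun t => (h t).deriv]
    exact contDiff_const.clm_comp ih

theorem continuous_uniformFun_clm_apply {T ι : Type*} [TopologicalSpace T] {u : T → F →L[ℝ] F'}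
    (hu : Continuous u) {v : ι → F} {C : ℝ} (hv : ∀ i, ‖v i‖ ≤ C) :
    Continuous (fun x => UniformFun.ofFun (fun i => u x (v i))) := by
  refine continuous_iff_continuousAt.2 fun x₀ => ?_
  refine UniformFun.tendsto_iff_tendstoUniformly.2 (Metric.tendstoUniformly_iff.2 fun ε hε => ?_)
  have h1 : Filter.Tendsto (fun x => ‖u x₀ - u x‖ * C) (𝓝 x₀) (𝓝 0) := by
    have : Continuous (fun x => ‖u x₀ - u x‖ * C) :=
      (continuous_const.sub hu).norm.mul continuous_const
    simpa using this.tendsto x₀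
  filter_upwards [h1.eventually (gt_mem_nhds hε)] with x hx i
  refine lt_of_le_of_lt ?_ hx
  change dist (u x₀ (v i)) (u x (v i)) ≤ _
  rw [dist_eq_norm, ← sub_apply]
  refine (ContinuousLinearMap.le_opNorm _ _).trans ?_
  gcongr
  exact hv i

end NormedSpaces

/-! ### One-parameter subgroups and the exponential map -/

section LieGroups

variable {E : Type*} [NormedAddCommGroup E] [NormedSpace ℝ E]
variable {G : Type*} [TopologicalSpace G] [ChartedSpace E G] [Group G]

theorem IsOneParam.map_zero {X : E} {γ : ℝ → G} (h : IsOneParam X γ) : γ 0 = 1 := by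
  have := h.map_add 0 0
  simpa using this

theorem mdifferentiable_const_mul [LieGroup 𝓘(ℝ, E) ∞ G] (a : G) :
    MDifferentiable 𝓘(ℝ, E) 𝓘(ℝ, E) (fun x : G => a * x) :=
  (contMDiff_mul_left (I := 𝓘(ℝ, E)) (n := ∞)).mdifferentiable (by simp)

theorem mdifferentiable_mul_const [LieGroup 𝓘(ℝ, E) ∞ G] (a : G) :
    MDifferentiable 𝓘(ℝ, E) 𝓘(ℝ, E) (fun x : G => x * a) :=
  (contMDiff_mul_right (I := 𝓘(ℝ, E)) (n := ∞)).mdifferentiable (by simp)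

theorem mdifferentiable_conj [LieGroup 𝓘(ℝ, E) ∞ G] (a : G) :
    MDifferentiable 𝓘(ℝ, E) 𝓘(ℝ, E) (fun x : G => a * x * a⁻¹) :=
  (mdifferentiable_mul_const (E := E) a⁻¹).comp (mdifferentiable_const_mul a)

/-- Conjugation turns the one-parameter subgroup of `X` into that of `Ad g X`. -/
theorem IsOneParam.conj [LieGroup 𝓘(ℝ, E) ∞ G] {X : E} {γ : ℝ → G} (h : IsOneParam X γ) (g : G) :
    IsOneParam (lieAdj g X : E) (fun t => g * γ t * g⁻¹) where
  map_add s t := by simp [h.map_add, mul_assoc]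
  hasMFDerivAt := by
    have h1 : HasMFDerivAt 𝓘(ℝ, E) 𝓘(ℝ, E) (fun x : G => g * x * g⁻¹) (γ 0)
        (lieAdj g : E →L[ℝ] E) := by
      rw [h.map_zero]
      exact (mdifferentiable_conj g 1).hasMFDerivAt
    have h2 := h1.comp (0 : ℝ) h.hasMFDerivAt
    have h3 : (lieAdj g : E →L[ℝ] E).comp
        (ContinuousLinearMap.toSpanSingleton ℝ X : ℝ →L[ℝ] E)
        = ContinuousLinearMap.toSpanSingleton ℝ (lieAdj g X : E) := by
      ext; simp
    rw [← h3]
    exact h2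

theorem IsOneParam.comp_mul {X : E} {γ : ℝ → G} (h : IsOneParam X γ) (c : ℝ) :
    IsOneParam (c • X) (fun t => γ (c * t)) where
  map_add s t := by simp [mul_add, h.map_add]
  hasMFDerivAt := by
    have h1 : HasMFDerivAt 𝓘(ℝ, ℝ) 𝓘(ℝ, ℝ) (fun t : ℝ => c * t) 0
        (ContinuousLinearMap.toSpanSingleton ℝ c : ℝ →L[ℝ] ℝ) := by
      have := ((hasDerivAt_id (0 : ℝ)).const_mul c).hasFDerivAt
      simp only [mul_one] at this
      exact this.hasMFDerivAt
    have h2 : HasMFDerivAt 𝓘(ℝ, ℝ) 𝓘(ℝ, E) γ ((fun t : ℝ => c * t) 0)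
        (ContinuousLinearMap.toSpanSingleton ℝ X : ℝ →L[ℝ] E) := by
      have h0 : (fun t : ℝ => c * t) 0 = 0 := mul_zero c
      rw [h0]
      exact h.hasMFDerivAt
    have h3 := h2.comp (0 : ℝ) h1
    have h4 : (ContinuousLinearMap.toSpanSingleton ℝ X : ℝ →L[ℝ] E).comp
        (ContinuousLinearMap.toSpanSingleton ℝ c : ℝ →L[ℝ] ℝ)
        = ContinuousLinearMap.toSpanSingleton ℝ (c • X) := by
      ext; simp
    rw [← h4]
    exact h3

/-- The left-invariant vector field on `G` with value `X` at the identity. -/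
abbrev leftField (X : GroupLieAlgebra 𝓘(ℝ, E) G) (g : G) : TangentSpace 𝓘(ℝ, E) g :=
  mulInvariantVectorField X g

theorem leftField_one (X : GroupLieAlgebra 𝓘(ℝ, E) G) : leftField X (1 : G) = X := by
  have h : (fun x : G => 1 * x) = id := by funext x; simp
  change mfderiv 𝓘(ℝ, E) 𝓘(ℝ, E) (fun x : G => 1 * x) 1 X = X
  have h2 : mfderiv 𝓘(ℝ, E) 𝓘(ℝ, E) (fun x : G => 1 * x) 1 X =
      mfderiv 𝓘(ℝ, E) 𝓘(ℝ, E) (id : G → G) 1 X := congrArg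
    (fun f : G → G => (mfderiv 𝓘(ℝ, E) 𝓘(ℝ, E) f 1 : E →L[ℝ] E) X) h
  exact h2.trans (DFunLike.congr_fun (mfderiv_id (I := 𝓘(ℝ, E)) (M := G) (x := (1 : G))) X)

variable [LieGroup 𝓘(ℝ, E) ∞ G]

theorem contMDiff_leftField (X : GroupLieAlgebra 𝓘(ℝ, E) G) :
    ContMDiff 𝓘(ℝ, E) 𝓘(ℝ, E).tangent 1
      (fun g : G => (⟨g, leftField X g⟩ : TangentBundle 𝓘(ℝ, E) G)) := by
  refine (contMDiff_mulInvariantVectorField (I := 𝓘(ℝ, E)) (G := G) X).of_le ?_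
  rw [minSmoothness_of_isRCLikeNormedField]
  norm_num

theorem mfderiv_mul_left_leftField (X : GroupLieAlgebra 𝓘(ℝ, E) G) (a g : G) :
    mfderiv 𝓘(ℝ, E) 𝓘(ℝ, E) (fun x : G => a * x) g (leftField X g) = leftField X (a * g) := by
  have h1 : (fun x : G => a * g * x) = (fun x : G => a * x) ∘ (fun x : G => g * x) := by
    funext x; simp [mul_assoc]
  have h := mfderiv_comp_of_eq (I := 𝓘(ℝ, E)) (I' := 𝓘(ℝ, E)) (I'' := 𝓘(ℝ, E)) (x := (1 : G))
    (y := g) (g := fun x : G => a * x) (f := fun x : G => g * x)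
    (mdifferentiable_const_mul a _) (mdifferentiable_const_mul g _) (mul_one g)
  have h2 : (mfderiv 𝓘(ℝ, E) 𝓘(ℝ, E) (fun x : G => a * g * x) 1 : E →L[ℝ] E) =
      (mfderiv 𝓘(ℝ, E) 𝓘(ℝ, E) (fun x : G => a * x) g : E →L[ℝ] E).comp
        (mfderiv 𝓘(ℝ, E) 𝓘(ℝ, E) (fun x : G => g * x) 1 : E →L[ℝ] E) := by
    rw [h1]
    refine h.trans ?_
    rw [mul_one]
  exact (DFunLike.congr_fun h2 X).symm

/-- If a curve has at `t` the velocity prescribed by a left-invariant vector field, then so have its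
left translates. -/
theorem HasMFDerivWithinAt.mul_left_leftField {X : GroupLieAlgebra 𝓘(ℝ, E) G} {γ : ℝ → G} {t : ℝ}
    {s : Set ℝ} (a : G)
    (h : HasMFDerivWithinAt 𝓘(ℝ, ℝ) 𝓘(ℝ, E) γ s t
      ((1 : ℝ →L[ℝ] ℝ).smulRight (leftField X (γ t)))) :
    HasMFDerivWithinAt 𝓘(ℝ, ℝ) 𝓘(ℝ, E) (fun t => a * γ t) s t
      ((1 : ℝ →L[ℝ] ℝ).smulRight (leftField X (a * γ t))) := by
  have h1 := (mdifferentiable_const_mul (E := E) a (γ t)).hasMFDerivAt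
  have h2 := h1.comp_hasMFDerivWithinAt t h
  have h3 : (mfderiv 𝓘(ℝ, E) 𝓘(ℝ, E) (fun x : G => a * x) (γ t) : E →L[ℝ] E).comp
      ((1 : ℝ →L[ℝ] ℝ).smulRight (leftField X (γ t) : E)) =
      (1 : ℝ →L[ℝ] ℝ).smulRight (leftField X (a * γ t) : E) := by
    have h4 := mfderiv_mul_left_leftField X a (γ t)
    apply ContinuousLinearMap.ext
    intro c
    rw [← h4]
    exact (mfderiv 𝓘(ℝ, E) 𝓘(ℝ, E) (fun x : G => a * x) (γ t) : E →L[ℝ] E).map_smul c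
      (leftField X (γ t) : E)
  exact h2.congr_mfderiv h3

theorem IsMIntegralCurve.mul_left {X : GroupLieAlgebra 𝓘(ℝ, E) G} {γ : ℝ → G}
    (h : IsMIntegralCurve (I := 𝓘(ℝ, E)) γ (leftField X)) (a : G) :
    IsMIntegralCurve (I := 𝓘(ℝ, E)) (fun t => a * γ t) (leftField X) := fun t =>
  hasMFDerivWithinAt_univ.1
    (HasMFDerivWithinAt.mul_left_leftField a (hasMFDerivWithinAt_univ.2 (h t)))

/-- A one-parameter subgroup is an integral curve at all times, not only at `0`: near `t` it is the
left translate by `γ t` of itself near `0`. -/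
theorem IsOneParam.isMIntegralCurve {X : E} {γ : ℝ → G} (h : IsOneParam X γ) :
    IsMIntegralCurve (I := 𝓘(ℝ, E)) γ (leftField (E := E) X) := by
  intro t
  have h0 : (leftField (E := E) X (γ 0) : E) = X := by
    rw [h.map_zero]
    exact leftField_one (E := E) X
  have h1 : HasMFDerivAt 𝓘(ℝ, ℝ) 𝓘(ℝ, E) γ 0
      ((1 : ℝ →L[ℝ] ℝ).smulRight (leftField (E := E) X (γ 0) : E)) := by
    rw [h0]
    exact h.hasMFDerivAt
  have h2 : HasMFDerivAt 𝓘(ℝ, ℝ) 𝓘(ℝ, E) (fun s => γ t * γ s) 0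
      ((1 : ℝ →L[ℝ] ℝ).smulRight (leftField (E := E) X (γ t * γ 0) : E)) :=
    hasMFDerivWithinAt_univ.1
      (HasMFDerivWithinAt.mul_left_leftField (γ t) (hasMFDerivWithinAt_univ.2 h1))
  have h3 : HasMFDerivAt 𝓘(ℝ, ℝ) 𝓘(ℝ, ℝ) (fun s : ℝ => s - t) t
      (ContinuousLinearMap.id ℝ ℝ) :=
    ((hasFDerivAt_id t).sub_const t).hasMFDerivAt
  have h4 : HasMFDerivAt 𝓘(ℝ, ℝ) 𝓘(ℝ, E) (fun s => γ t * γ s) ((fun s : ℝ => s - t) t)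
      ((1 : ℝ →L[ℝ] ℝ).smulRight (leftField (E := E) X (γ t * γ 0) : E)) := by
    have h0 : (fun s : ℝ => s - t) t = 0 := sub_self t
    rw [h0]
    exact h2
  have h5 := HasMFDerivAt.comp (f := fun s : ℝ => s - t) t h4 h3
  have h6 : ((fun s => γ t * γ s) ∘ fun s : ℝ => s - t) = γ := by
    funext s
    simp [← h.map_add]
  rw [h6, h.map_zero, mul_one] at h5
  exact h5

theorem IsOneParam.unique [FiniteDimensional ℝ E] [T2Space G] {X : E} {γ γ' : ℝ → G}
    (h : IsOneParam X γ) (h' : IsOneParam X γ') : γ = γ' := by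
  have : CompleteSpace E := FiniteDimensional.complete ℝ E
  exact isMIntegralCurve_Ioo_eq_of_contMDiff_boundaryless (t₀ := 0)
    (contMDiff_leftField X) (IsOneParam.isMIntegralCurve h) (IsOneParam.isMIntegralCurve h')
    (h.map_zero.trans h'.map_zero.symm)

/-- Left translations turn a local integral curve of a left-invariant vector field through `1` into
local integral curves through all points, defined for the same time; so the field is complete. -/
theorem exists_isOneParam [FiniteDimensional ℝ E] [T2Space G] (X : E) :
    ∃ γ : ℝ → G, IsOneParam X γ := by
  have : CompleteSpace E := FiniteDimensional.complete ℝ E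
  have hv := contMDiff_leftField (G := G) X
  obtain ⟨γ₁, h0, h1⟩ := exists_isMIntegralCurveAt_of_contMDiffAt_boundaryless (I := 𝓘(ℝ, E))
    (x₀ := (1 : G)) 0 hv.contMDiffAt
  rw [isMIntegralCurveAt_iff'] at h1
  obtain ⟨ε, hε, h1⟩ := h1
  have hloc : ∀ x : G, ∃ γ : ℝ → G, γ 0 = x ∧ IsMIntegralCurveOn (I := 𝓘(ℝ, E)) γ
      (leftField (E := E) X) (Set.Ioo (-ε) ε) := by
    intro x
    have hb : Metric.ball (0 : ℝ) ε = Set.Ioo (-ε) ε := by simp [Real.ball_eq_Ioo]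
    rw [← hb]
    exact ⟨fun t => x * γ₁ t, by simp [h0], fun t ht =>
      HasMFDerivWithinAt.mul_left_leftField x (h1 t ht)⟩
  obtain ⟨γ, hγ0, hγ⟩ := exists_isMIntegralCurve_of_isMIntegralCurveOn hv hε hloc 1
  refine ⟨γ, ⟨fun s t => ?_, ?_⟩⟩
  · have := isMIntegralCurve_Ioo_eq_of_contMDiff_boundaryless (t₀ := 0) hv
      (IsMIntegralCurve.mul_left hγ (γ s)) (hγ.comp_add s) (by simp [hγ0])
    have := congrFun this t
    simpa [add_comm] using this.symm
  · have h1 : HasMFDerivAt 𝓘(ℝ, ℝ) 𝓘(ℝ, E) γ 0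
      ((1 : ℝ →L[ℝ] ℝ).smulRight (leftField (E := E) X (γ 0) : E)) := hγ 0
    have h0 : (leftField (E := E) X (γ 0) : E) = X := by
      rw [hγ0]
      exact leftField_one (E := E) X
    rw [h0] at h1
    exact h1

variable [FiniteDimensional ℝ E] [T2Space G]

theorem IsOneParam.lieExp_smul {X : E} {γ : ℝ → G} (h : IsOneParam X γ) (t : ℝ) :
    lieExp G (t • X) = γ t := by
  have hex : ∃ γ : ℝ → G, IsOneParam (t • X) γ := ⟨_, h.comp_mul t⟩
  unfold lieExp
  rw [dif_pos hex, hex.choose_spec.unique (h.comp_mul t)]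
  simp only [mul_one]

/-- `t ↦ exp (t X)` is the one-parameter subgroup with initial velocity `X`. -/
theorem isOneParam_lieExp (X : E) : IsOneParam X (fun t : ℝ => lieExp G (t • X)) := by
  obtain ⟨γ, h⟩ := exists_isOneParam (G := G) X
  simpa only [h.lieExp_smul] using h

theorem lieExp_zero : lieExp G (0 : E) = 1 := by
  have h := (isOneParam_lieExp (G := G) (0 : E)).map_zero
  simpa using h

theorem lieExp_lieAdj (g : G) (X : E) (t : ℝ) :
    lieExp G (t • (lieAdj g X : E)) = g * lieExp G (t • X) * g⁻¹ :=
  ((isOneParam_lieExp X).conj g).lieExp_smul t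

end LieGroups

/-! ### The adjoint representation and the Lie bracket -/

section Adjoint

variable {E : Type*} [NormedAddCommGroup E] [NormedSpace ℝ E]
variable {G : Type*} [TopologicalSpace G] [ChartedSpace E G] [Group G]

open VectorField Filter Topology in
/-- The local computation behind `d/dt Ad (exp tX) Y = [X, Y]`. Here `m` is the multiplication in a
chart in which the identity is `p`; then `fderiv ℝ m (x, p) (0, v)` is the left-invariant vector
field with value `v` at `p`, and `A x` is the adjoint representation. -/
theorem fderiv_adjoint_eq_lieBracket {m : E × E → E} {p : E} {A : E → E →L[ℝ] E}
    (hm : ContDiffAt ℝ 2 m (p, p)) (hA : DifferentiableAt ℝ A p)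
    (hAp : A p = ContinuousLinearMap.id ℝ E)
    (hl : ∀ᶠ y in 𝓝 p, m (p, y) = y) (hr : ∀ᶠ x in 𝓝 p, m (x, p) = x)
    (hLR : ∀ᶠ x in 𝓝 p, ∀ v, fderiv ℝ m (x, p) (0, v) = fderiv ℝ m (p, x) (A x v, 0)) (v w : E) :
    fderiv ℝ A p v w = lieBracket ℝ (fun x => fderiv ℝ m (x, p) (0, v))
      (fun x => fderiv ℝ m (x, p) (0, w)) p := by
  have hmd : DifferentiableAt ℝ m (p, p) := hm.differentiableAt (by norm_num)
  have hd : DifferentiableAt ℝ (fderiv ℝ m) (p, p) :=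
    (hm.fderiv_right (m := 1) (by norm_num)).differentiableAt (by norm_num)
  have hsymm : IsSymmSndFDerivAt ℝ m (p, p) := hm.isSymmSndFDerivAt (by simp)
  have hx : HasFDerivAt (fun x : E => (x, p)) (ContinuousLinearMap.inl ℝ E E) p :=
    hasFDerivAt_prodMk_left p p
  have hy : HasFDerivAt (fun y : E => (p, y)) (ContinuousLinearMap.inr ℝ E E) p :=
    hasFDerivAt_prodMk_right p p
  have h1 : ∀ u, fderiv ℝ m (p, p) (0, u) = u := fun u => by
    have h := (HasFDerivAt.comp (f := fun y : E => (p, y)) p hmd.hasFDerivAt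
      hy).congr_of_eventuallyEq (f₁ := id) (hl.mono fun y hy => hy.symm)
    simpa using (DFunLike.congr_fun (h.unique (hasFDerivAt_id p)) u)
  have h2 : ∀ u, fderiv ℝ m (p, p) (u, 0) = u := fun u => by
    have h := (HasFDerivAt.comp (f := fun y : E => (y, p)) p hmd.hasFDerivAt
      hx).congr_of_eventuallyEq (f₁ := id) (hr.mono fun y hy => hy.symm)
    simpa using (DFunLike.congr_fun (h.unique (hasFDerivAt_id p)) u)
  have hL : ∀ u, HasFDerivAt (fun x => fderiv ℝ m (x, p) (0, u))
      (((fderiv ℝ (fderiv ℝ m) (p, p)).comp (ContinuousLinearMap.inl ℝ E E)).flip (0, u)) p :=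
    fun u => by
      have := (HasFDerivAt.comp (f := fun y : E => (y, p)) p hd.hasFDerivAt hx).clm_apply
        (hasFDerivAt_const ((0 : E), u) p)
      simpa using this
  have hAw : HasFDerivAt (fun x => (A x w, (0 : E)))
      ((ContinuousLinearMap.inl ℝ E E).comp ((fderiv ℝ A p).flip w)) p := by
    have := hA.hasFDerivAt.clm_apply (hasFDerivAt_const w p)
    have h3 := (ContinuousLinearMap.inl ℝ E E).hasFDerivAt.comp p this
    simp only [ContinuousLinearMap.comp_zero, zero_add] at h3
    exact h3
  have hR := (HasFDerivAt.comp (f := fun y : E => (p, y)) p hd.hasFDerivAt hy).clm_apply hAw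
  -- Differentiate `hLR` at `p` in the direction `v`, once from each side.
  have hEq := (hR.congr_of_eventuallyEq (f₁ := fun x => fderiv ℝ m (x, p) (0, w))
    (hLR.mono fun x hx => hx w)).unique (hL w)
  have key := DFunLike.congr_fun hEq v
  simp [hAp, h2] at key
  rw [lieBracket, (hL w).fderiv, (hL v).fderiv, h1, h1]
  simp only [ContinuousLinearMap.flip_apply, ContinuousLinearMap.comp_apply,
    ContinuousLinearMap.inl_apply]
  rw [hsymm (w, 0) (0, v), ← key]
  abel


theorem lieAdj_one : (lieAdj (1 : G) : E →L[ℝ] E) = ContinuousLinearMap.id ℝ E := by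
  have h : (fun x : G => 1 * x * 1⁻¹) = id := by funext x; simp
  unfold lieAdj
  rw [h]
  exact mfderiv_id

variable [LieGroup 𝓘(ℝ, E) ∞ G]

theorem mfderiv_extChartAt_one :
    (mfderiv 𝓘(ℝ, E) 𝓘(ℝ, E) (extChartAt 𝓘(ℝ, E) (1 : G)) 1 : E →L[ℝ] E)
      = ContinuousLinearMap.id ℝ E :=
  mfderiv_extChartAt_self (I := 𝓘(ℝ, E)) (x := (1 : G))

variable (E G) in
/-- The adjoint representation is smooth. -/
theorem contMDiff_lieAdj :
    ContMDiff 𝓘(ℝ, E) 𝓘(ℝ, E →L[ℝ] E) ∞ (fun g : G => (lieAdj g : E →L[ℝ] E)) := by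
  intro g₀
  have hf : ContMDiffAt (𝓘(ℝ, E).prod 𝓘(ℝ, E)) 𝓘(ℝ, E) ∞
      (Function.uncurry fun g x : G => g * x * g⁻¹) (g₀, 1) := by
    have : ContMDiff (𝓘(ℝ, E).prod 𝓘(ℝ, E)) 𝓘(ℝ, E) ∞
        (fun q : G × G => q.1 * q.2 * q.1⁻¹) :=
      (contMDiff_fst.mul contMDiff_snd).mul contMDiff_fst.inv
    exact this _
  have h := ContMDiffAt.mfderiv (m := ∞) (fun g x : G => g * x * g⁻¹) (fun _ => 1) hf
    contMDiffAt_const (by simp)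
  refine h.congr_of_eventuallyEq (Filter.Eventually.of_forall fun g => ?_)
  have hs : ∀ a : G, a * 1 * a⁻¹ = 1 := by simp
  refine Eq.trans ?_ (inTangentCoordinates_eq_mfderiv_comp (I := 𝓘(ℝ, E)) (I' := 𝓘(ℝ, E))
    (f := fun _ : G => (1 : G)) (g := fun x : G => x * 1 * x⁻¹)
    (ϕ := fun x : G => mfderiv 𝓘(ℝ, E) 𝓘(ℝ, E) (fun y : G => x * y * x⁻¹) 1)
    (x₀ := g₀) (x := g) (mem_chart_source E (1 : G))
    (by simp only [hs]; exact mem_chart_source E (1 : G))).symm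
  have h1 : (mfderiv 𝓘(ℝ, E) 𝓘(ℝ, E) (extChartAt 𝓘(ℝ, E) (g₀ * 1 * g₀⁻¹ : G))
      (g * 1 * g⁻¹) : E →L[ℝ] E) = ContinuousLinearMap.id ℝ E := by
    rw [hs, hs]
    exact mfderiv_extChartAt_one
  have h2 : (mfderivWithin 𝓘(ℝ, E) 𝓘(ℝ, E) (extChartAt 𝓘(ℝ, E) (1 : G)).symm
      (Set.range 𝓘(ℝ, E)) (extChartAt 𝓘(ℝ, E) (1 : G) 1) : E →L[ℝ] E)
      = ContinuousLinearMap.id ℝ E :=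
    mfderivWithin_range_extChartAt_symm (I := 𝓘(ℝ, E)) (x := (1 : G))
  change (lieAdj g : E →L[ℝ] E) = (mfderiv 𝓘(ℝ, E) 𝓘(ℝ, E)
    (extChartAt 𝓘(ℝ, E) (g₀ * 1 * g₀⁻¹ : G)) (g * 1 * g⁻¹) : E →L[ℝ] E).comp
    ((lieAdj g : E →L[ℝ] E).comp (mfderivWithin 𝓘(ℝ, E) 𝓘(ℝ, E)
      (extChartAt 𝓘(ℝ, E) (1 : G)).symm (Set.range 𝓘(ℝ, E)) (extChartAt 𝓘(ℝ, E) (1 : G) 1) :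
        E →L[ℝ] E))
  rw [h1, h2]
  rfl

/-- The differential at the identity of `f`, read in the chart at the identity. -/
theorem hasFDerivAt_extChartAt_comp {f : G → G} (hf : MDifferentiableAt 𝓘(ℝ, E) 𝓘(ℝ, E) f 1)
    (hs : f 1 ∈ (chartAt E (1 : G)).source) :
    HasFDerivAt (fun y => extChartAt 𝓘(ℝ, E) (1 : G) (f ((extChartAt 𝓘(ℝ, E) (1 : G)).symm y)))
      ((mfderiv 𝓘(ℝ, E) 𝓘(ℝ, E) (extChartAt 𝓘(ℝ, E) (1 : G)) (f 1) : E →L[ℝ] E).comp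
        (mfderiv 𝓘(ℝ, E) 𝓘(ℝ, E) f 1 : E →L[ℝ] E)) (extChartAt 𝓘(ℝ, E) (1 : G) 1) := by
  have hp : (extChartAt 𝓘(ℝ, E) (1 : G)).symm (extChartAt 𝓘(ℝ, E) (1 : G) 1) = 1 :=
    extChartAt_to_inv 1
  have h1 : HasMFDerivAt 𝓘(ℝ, E) 𝓘(ℝ, E) (extChartAt 𝓘(ℝ, E) (1 : G)).symm
      (extChartAt 𝓘(ℝ, E) (1 : G) 1) (ContinuousLinearMap.id ℝ E) := by
    have h := (mdifferentiableWithinAt_extChartAt_symm (I := 𝓘(ℝ, E))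
      (mem_extChartAt_target (I := 𝓘(ℝ, E)) (1 : G))).hasMFDerivWithinAt
    have h' := h.congr_mfderiv (mfderivWithin_range_extChartAt_symm (I := 𝓘(ℝ, E)) (x := (1 : G)))
    have hu : Set.range 𝓘(ℝ, E) = Set.univ := by simp
    rw [hu] at h'
    exact hasMFDerivWithinAt_univ.1 h'
  have h2 : HasMFDerivAt 𝓘(ℝ, E) 𝓘(ℝ, E) f
      ((extChartAt 𝓘(ℝ, E) (1 : G)).symm (extChartAt 𝓘(ℝ, E) (1 : G) 1))
      (mfderiv 𝓘(ℝ, E) 𝓘(ℝ, E) f 1 : E →L[ℝ] E) := by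
    rw [hp]
    exact hf.hasMFDerivAt
  have h3 : HasMFDerivAt 𝓘(ℝ, E) 𝓘(ℝ, E) (extChartAt 𝓘(ℝ, E) (1 : G))
      ((f ∘ (extChartAt 𝓘(ℝ, E) (1 : G)).symm) (extChartAt 𝓘(ℝ, E) (1 : G) 1))
      (mfderiv 𝓘(ℝ, E) 𝓘(ℝ, E) (extChartAt 𝓘(ℝ, E) (1 : G)) (f 1) : E →L[ℝ] E) := by
    rw [Function.comp_apply, hp]
    exact (mdifferentiableAt_extChartAt hs).hasMFDerivAt
  exact hasMFDerivAt_iff_hasFDerivAt.1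
    (HasMFDerivAt.comp (extChartAt 𝓘(ℝ, E) (1 : G) 1) h3 (HasMFDerivAt.comp _ h2 h1))

/-- `d L_g = d R_g ∘ Ad g` at the identity. -/
theorem mfderiv_mul_left_eq_mfderiv_mul_right_comp_lieAdj (g : G) :
    (mfderiv 𝓘(ℝ, E) 𝓘(ℝ, E) (fun x : G => g * x) 1 : E →L[ℝ] E) =
      (mfderiv 𝓘(ℝ, E) 𝓘(ℝ, E) (fun x : G => x * g) 1 : E →L[ℝ] E).comp
        (lieAdj g : E →L[ℝ] E) := by
  have h1 : (fun x : G => g * x) = (fun x : G => x * g) ∘ (fun x : G => g * x * g⁻¹) := by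
    funext x; simp
  have h2 : g * 1 * g⁻¹ = 1 := by simp
  have h := mfderiv_comp_of_eq (I := 𝓘(ℝ, E)) (I' := 𝓘(ℝ, E)) (I'' := 𝓘(ℝ, E)) (x := (1 : G))
    (y := 1) (g := fun x : G => x * g) (f := fun x : G => g * x * g⁻¹)
    (mdifferentiable_mul_const g _) (mdifferentiable_conj g _) (by simp)
  rw [h1]
  refine h.trans ?_
  rw [h2]
  rfl

variable (E G) in
/-- The multiplication of `G` in the chart at the identity. -/
def chartMul (q : E × E) : E :=
  extChartAt 𝓘(ℝ, E) (1 : G) ((extChartAt 𝓘(ℝ, E) (1 : G)).symm q.1 *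
    (extChartAt 𝓘(ℝ, E) (1 : G)).symm q.2)

theorem contMDiffAt_extChartAt_symm_one :
    ContMDiffAt 𝓘(ℝ, E) 𝓘(ℝ, E) ∞ (extChartAt 𝓘(ℝ, E) (1 : G)).symm
      (extChartAt 𝓘(ℝ, E) (1 : G) 1) :=
  (contMDiffOn_extChartAt_symm (I := 𝓘(ℝ, E)) (n := ∞) (1 : G)).contMDiffAt
    (extChartAt_target_mem_nhds (1 : G))

theorem contDiffAt_chartMul :
    ContDiffAt ℝ ∞ (chartMul E G)
      (extChartAt 𝓘(ℝ, E) (1 : G) 1, extChartAt 𝓘(ℝ, E) (1 : G) 1) := by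
  rw [← contMDiffAt_iff_contDiffAt]
  have hp : (extChartAt 𝓘(ℝ, E) (1 : G)).symm (extChartAt 𝓘(ℝ, E) (1 : G) 1) = 1 :=
    extChartAt_to_inv 1
  have h1 : ContMDiffAt 𝓘(ℝ, E × E) 𝓘(ℝ, E) ∞
      (fun q : E × E => (extChartAt 𝓘(ℝ, E) (1 : G)).symm q.1)
      (extChartAt 𝓘(ℝ, E) (1 : G) 1, extChartAt 𝓘(ℝ, E) (1 : G) 1) :=
    ContMDiffAt.comp (I' := 𝓘(ℝ, E)) (g := (extChartAt 𝓘(ℝ, E) (1 : G)).symm)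
      (f := fun q : E × E => q.1) _
      contMDiffAt_extChartAt_symm_one contDiff_fst.contMDiff.contMDiffAt
  have h2 : ContMDiffAt 𝓘(ℝ, E × E) 𝓘(ℝ, E) ∞
      (fun q : E × E => (extChartAt 𝓘(ℝ, E) (1 : G)).symm q.2)
      (extChartAt 𝓘(ℝ, E) (1 : G) 1, extChartAt 𝓘(ℝ, E) (1 : G) 1) :=
    ContMDiffAt.comp (I' := 𝓘(ℝ, E)) (g := (extChartAt 𝓘(ℝ, E) (1 : G)).symm)
      (f := fun q : E × E => q.2) _
      contMDiffAt_extChartAt_symm_one contDiff_snd.contMDiff.contMDiffAt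
  refine ContMDiffAt.comp (I' := 𝓘(ℝ, E)) (g := extChartAt 𝓘(ℝ, E) (1 : G))
    _ ?_ (h1.mul h2)
  simp only [hp, mul_one]
  exact contMDiffAt_extChartAt

open VectorField Filter Topology in
/-- The differential of the adjoint representation, in the chart at the identity, is the Lie
bracket. -/
theorem fderiv_lieAdj_extChartAt_symm [FiniteDimensional ℝ E] (X Y : E) :
    fderiv ℝ (fun x => (lieAdj ((extChartAt 𝓘(ℝ, E) (1 : G)).symm x) : E →L[ℝ] E))
      (extChartAt 𝓘(ℝ, E) (1 : G) 1) X Y = lieBr G X Y := by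
  have hp : (extChartAt 𝓘(ℝ, E) (1 : G)).symm (extChartAt 𝓘(ℝ, E) (1 : G) 1) = 1 :=
    extChartAt_to_inv 1
  have hmem : ∀ᶠ x in 𝓝 (extChartAt 𝓘(ℝ, E) (1 : G) 1), x ∈ (extChartAt 𝓘(ℝ, E) (1 : G)).target :=
    extChartAt_target_mem_nhds (1 : G)
  have hdiff : ∀ᶠ q in 𝓝 (extChartAt 𝓘(ℝ, E) (1 : G) 1, extChartAt 𝓘(ℝ, E) (1 : G) 1),
      DifferentiableAt ℝ (chartMul E G) q := by
    have h := (contDiffAt_chartMul (E := E) (G := G)).of_le (m := 1) (by simp)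
    exact (h.eventually (by simp)).mono fun q hq => hq.differentiableAt (by simp)
  -- The partial differentials of the multiplication are the differentials at `1` of left and right
  -- translations, followed by the differential of the chart.
  have hleft : ∀ᶠ x in 𝓝 (extChartAt 𝓘(ℝ, E) (1 : G) 1), ∀ v : E,
      fderiv ℝ (chartMul E G) (x, extChartAt 𝓘(ℝ, E) (1 : G) 1) (0, v) =
      (mfderiv 𝓘(ℝ, E) 𝓘(ℝ, E) (extChartAt 𝓘(ℝ, E) (1 : G))
        ((extChartAt 𝓘(ℝ, E) (1 : G)).symm x) : E →L[ℝ] E)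
        ((mfderiv 𝓘(ℝ, E) 𝓘(ℝ, E) (fun y : G => (extChartAt 𝓘(ℝ, E) (1 : G)).symm x * y) 1 :
          E →L[ℝ] E) v) := by
    have hc : ContinuousAt (fun x : E => (x, extChartAt 𝓘(ℝ, E) (1 : G) 1))
      (extChartAt 𝓘(ℝ, E) (1 : G) 1) := by fun_prop
    filter_upwards [hmem, hc.eventually hdiff] with x hx hd v
    have hs : (extChartAt 𝓘(ℝ, E) (1 : G)).symm x * 1 ∈ (chartAt E (1 : G)).source := by
      rw [mul_one]
      simpa using (extChartAt 𝓘(ℝ, E) (1 : G)).map_target hx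
    have h1 := hasFDerivAt_extChartAt_comp (mdifferentiable_const_mul (E := E) _ 1) hs
    have h2 := hd.hasFDerivAt.comp _
      (hasFDerivAt_prodMk_right (𝕜 := ℝ) x (extChartAt 𝓘(ℝ, E) (1 : G) 1))
    have h3 := DFunLike.congr_fun (h2.unique h1) v
    rw [mul_one] at h3
    exact h3
  have hright : ∀ᶠ x in 𝓝 (extChartAt 𝓘(ℝ, E) (1 : G) 1), ∀ v : E,
      fderiv ℝ (chartMul E G) (extChartAt 𝓘(ℝ, E) (1 : G) 1, x) (v, 0) =
      (mfderiv 𝓘(ℝ, E) 𝓘(ℝ, E) (extChartAt 𝓘(ℝ, E) (1 : G))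
        ((extChartAt 𝓘(ℝ, E) (1 : G)).symm x) : E →L[ℝ] E)
        ((mfderiv 𝓘(ℝ, E) 𝓘(ℝ, E) (fun y : G => y * (extChartAt 𝓘(ℝ, E) (1 : G)).symm x) 1 :
          E →L[ℝ] E) v) := by
    have hc : ContinuousAt (fun x : E => (extChartAt 𝓘(ℝ, E) (1 : G) 1, x))
      (extChartAt 𝓘(ℝ, E) (1 : G) 1) := by fun_prop
    filter_upwards [hmem, hc.eventually hdiff] with x hx hd v
    have hs : 1 * (extChartAt 𝓘(ℝ, E) (1 : G)).symm x ∈ (chartAt E (1 : G)).source := by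
      rw [one_mul]
      simpa using (extChartAt 𝓘(ℝ, E) (1 : G)).map_target hx
    have h1 := hasFDerivAt_extChartAt_comp (mdifferentiable_mul_const (E := E) _ 1) hs
    have h2 := HasFDerivAt.comp (f := fun y : E => (y, x)) _ hd.hasFDerivAt
      (hasFDerivAt_prodMk_left (𝕜 := ℝ) (extChartAt 𝓘(ℝ, E) (1 : G) 1) x)
    have h3 := DFunLike.congr_fun (h2.unique h1) v
    rw [one_mul] at h3
    exact h3
  have hA : DifferentiableAt ℝ
      (fun x => (lieAdj ((extChartAt 𝓘(ℝ, E) (1 : G)).symm x) : E →L[ℝ] E))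
      (extChartAt 𝓘(ℝ, E) (1 : G) 1) := by
    have h := (contMDiff_lieAdj E G).contMDiffAt.comp (extChartAt 𝓘(ℝ, E) (1 : G) 1)
      contMDiffAt_extChartAt_symm_one
    exact (contMDiffAt_iff_contDiffAt.1 h).differentiableAt (by simp)
  rw [fderiv_adjoint_eq_lieBracket (m := chartMul E G)
    (contDiffAt_chartMul.of_le (by norm_cast)) hA]
  rotate_left
  · rw [hp]
    exact lieAdj_one
  · filter_upwards [hmem] with y hy
    unfold chartMul
    rw [hp, one_mul, (extChartAt 𝓘(ℝ, E) (1 : G)).right_inv hy]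
  · filter_upwards [hmem] with y hy
    unfold chartMul
    rw [hp, mul_one, (extChartAt 𝓘(ℝ, E) (1 : G)).right_inv hy]
  · filter_upwards [hleft, hright] with x h1 h2 v
    rw [h1, h2, mfderiv_mul_left_eq_mfderiv_mul_right_comp_lieAdj]
    rfl
  -- These are the left-invariant vector fields read in the chart, as in the definition of the
  -- bracket of vector fields on a manifold.
  have hpull : ∀ Z : E, (fun x => fderiv ℝ (chartMul E G) (x, extChartAt 𝓘(ℝ, E) (1 : G) 1) (0, Z))
      =ᶠ[𝓝 (extChartAt 𝓘(ℝ, E) (1 : G) 1)]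
      mpullbackWithin 𝓘(ℝ, E) 𝓘(ℝ, E) (extChartAt 𝓘(ℝ, E) (1 : G)).symm
        (leftField (E := E) Z) (Set.range 𝓘(ℝ, E)) := by
    intro Z
    filter_upwards [hleft, hmem] with x h1 hx
    rw [h1, mpullbackWithin_apply, ContinuousLinearMap.inverse_eq
      (mfderivWithin_extChartAt_symm_comp_mfderiv_extChartAt hx)
      (mfderiv_extChartAt_comp_mfderivWithin_extChartAt_symm hx)]
    rfl
  have h1 := Filter.EventuallyEq.lieBracket_vectorField_eq (𝕜 := ℝ) (hpull X) (hpull Y)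
  rw [h1]
  have hid : ∀ T : E →L[ℝ] E, T = ContinuousLinearMap.id ℝ E → ∀ u, T.inverse u = u := by
    rintro _ rfl u
    rw [ContinuousLinearMap.inverse_id]
    rfl
  have hu : (extChartAt 𝓘(ℝ, E) (1 : G)).symm ⁻¹' Set.univ ∩ Set.range 𝓘(ℝ, E) = Set.univ := by
    simp
  refine Eq.trans ?_ (hid _ (mfderiv_extChartAt_one (G := G)) _).symm
  rw [hu]
  exact (congrFun lieBracketWithin_univ _).symm

/-- `d/dt Ad (exp tX) = ad X` at `t = 0`. -/
theorem IsOneParam.hasDerivAt_lieAdj_zero [FiniteDimensional ℝ E] {X : E} {γ : ℝ → G}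
    (h : IsOneParam X γ) : HasDerivAt (fun t => (lieAdj (γ t) : E →L[ℝ] E)) (lieAd G X) 0 := by
  have h1 : HasMFDerivAt 𝓘(ℝ, E) 𝓘(ℝ, E) (extChartAt 𝓘(ℝ, E) (1 : G)) (γ 0)
      (ContinuousLinearMap.id ℝ E) := by
    rw [h.map_zero]
    exact (mdifferentiableAt_extChartAt (mem_chart_source E (1 : G))).hasMFDerivAt.congr_mfderiv
      mfderiv_extChartAt_one
  have h2 : HasDerivAt (fun t => extChartAt 𝓘(ℝ, E) (1 : G) (γ t)) X 0 := by
    have h3 := hasMFDerivAt_iff_hasFDerivAt.1 (HasMFDerivAt.comp (0 : ℝ) h1 h.hasMFDerivAt)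
    have h4 : (ContinuousLinearMap.id ℝ E).comp (ContinuousLinearMap.toSpanSingleton ℝ X) =
      ContinuousLinearMap.toSpanSingleton ℝ X := ContinuousLinearMap.id_comp _
    exact hasDerivAt_iff_hasFDerivAt.2 (HasFDerivAt.congr_fderiv h3 h4)
  have hA : DifferentiableAt ℝ
      (fun x => (lieAdj ((extChartAt 𝓘(ℝ, E) (1 : G)).symm x) : E →L[ℝ] E))
      (extChartAt 𝓘(ℝ, E) (1 : G) (γ 0)) := by
    have h := (contMDiff_lieAdj E G).contMDiffAt.comp (extChartAt 𝓘(ℝ, E) (1 : G) 1)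
      contMDiffAt_extChartAt_symm_one
    rw [‹IsOneParam X γ›.map_zero]
    exact (contMDiffAt_iff_contDiffAt.1 h).differentiableAt (by simp)
  have h3 := hA.hasFDerivAt.comp_hasDerivAt (0 : ℝ) h2
  have h4 : fderiv ℝ (fun x => (lieAdj ((extChartAt 𝓘(ℝ, E) (1 : G)).symm x) : E →L[ℝ] E))
      (extChartAt 𝓘(ℝ, E) (1 : G) (γ 0)) X = lieAd G X := by
    rw [h.map_zero]
    ext Y
    exact fderiv_lieAdj_extChartAt_symm X Y
  rw [h4] at h3
  refine h3.congr_of_eventuallyEq ?_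
  have hc : ContinuousAt γ 0 := h.hasMFDerivAt.continuousAt
  have hs : ∀ᶠ t in 𝓝 (0 : ℝ), γ t ∈ (extChartAt 𝓘(ℝ, E) (1 : G)).source :=
    hc.eventually (by rw [h.map_zero]; exact extChartAt_source_mem_nhds (I := 𝓘(ℝ, E)) (1 : G))
  filter_upwards [hs] with t ht
  simp only [Function.comp_apply]
  rw [(extChartAt 𝓘(ℝ, E) (1 : G)).left_inv ht]

end Adjoint

/-! ### The coadjoint representation -/

section CoadjointAction

variable {E : Type*} [NormedAddCommGroup E] [NormedSpace ℝ E]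
variable {G : Type*} [TopologicalSpace G] [ChartedSpace E G] [Group G]

variable (E) in
/-- The transpose `A ↦ (ν ↦ ν ∘ A)`. -/
def dualMapCLM : (E →L[ℝ] E) →L[ℝ] ((E →L[ℝ] ℝ) →L[ℝ] (E →L[ℝ] ℝ)) :=
  (ContinuousLinearMap.compL ℝ E E ℝ).flip

/-- `Ad*(g)` as a continuous linear endomorphism of the dual of the Lie algebra. -/
def coAdCLM (g : G) : (E →L[ℝ] ℝ) →L[ℝ] (E →L[ℝ] ℝ) :=
  dualMapCLM E (lieAdj g⁻¹)

theorem coAd_one (ν : E →L[ℝ] ℝ) : coAd (1 : G) ν = ν := by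
  unfold coAd
  rw [inv_one, lieAdj_one]
  rfl

variable [LieGroup 𝓘(ℝ, E) ∞ G]

theorem coAdCLM_mul (g h : G) :
    (coAdCLM (g * h) : (E →L[ℝ] ℝ) →L[ℝ] (E →L[ℝ] ℝ)) = (coAdCLM g).comp (coAdCLM h) := by
  ext1 ν
  exact coAd_mul g h ν

variable (E G) in
theorem continuous_coAdCLM :
    Continuous (fun g : G => (coAdCLM g : (E →L[ℝ] ℝ) →L[ℝ] (E →L[ℝ] ℝ))) := by
  have : IsTopologicalGroup G := topologicalGroup_of_lieGroup 𝓘(ℝ, E) ∞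
  exact (dualMapCLM E).continuous.comp
    ((contMDiff_lieAdj E G).continuous.comp continuous_inv)

/-- The orbit is bounded, being the image of the compact group `G`. -/
theorem CoadjointOrbit.exists_norm_val_le [CompactSpace G] (η : E →L[ℝ] ℝ) :
    ∃ C, ∀ ν : CoadjointOrbit G η, ‖ν.val‖ ≤ C := by
  obtain ⟨C, hC⟩ := (isCompact_range
    ((continuous_coAdCLM E G).clm_apply (continuous_const (y := η)))).isBounded.exists_norm_le
  refine ⟨C, fun ⟨ν, g, hg⟩ => ?_⟩
  subst hg
  exact hC _ ⟨g, rfl⟩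

section Derivatives

variable [FiniteDimensional ℝ E]

variable (G) in
/-- `ad*_X` as a continuous linear endomorphism of the dual of the Lie algebra. -/
def coadInfCLM (X : E) : (E →L[ℝ] ℝ) →L[ℝ] (E →L[ℝ] ℝ) :=
  dualMapCLM E (-lieAd G X)

theorem coadInfCLM_apply (X : E) (ν : E →L[ℝ] ℝ) : coadInfCLM G X ν = coadInf G X ν := by
  ext Y
  simp [coadInfCLM, coadInf, dualMapCLM]

/-- `d/dt Ad* (exp tX) = ad*_X ∘ Ad* (exp tX)`. -/
theorem IsOneParam.hasDerivAt_coAdCLM {X : E} {γ : ℝ → G} (h : IsOneParam X γ) (t : ℝ) :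
    HasDerivAt (fun s => (coAdCLM (γ s) : (E →L[ℝ] ℝ) →L[ℝ] (E →L[ℝ] ℝ)))
      ((coadInfCLM G X).comp (coAdCLM (γ t))) t := by
  have hinv : ∀ s, (γ s)⁻¹ = γ (-s) := fun s => by
    rw [inv_eq_iff_mul_eq_one, ← h.map_add, add_neg_cancel, h.map_zero]
  have h0 : HasDerivAt (fun s => (coAdCLM (γ s) : (E →L[ℝ] ℝ) →L[ℝ] (E →L[ℝ] ℝ)))
      (coadInfCLM G X) 0 := by
    have h1 : HasDerivAt (fun s : ℝ => (lieAdj (γ (-s)) : E →L[ℝ] E)) (-lieAd G X) 0 := by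
      have h2 : HasDerivAt (fun t => (lieAdj (γ t) : E →L[ℝ] E)) (lieAd G X) (-0) := by
        rw [neg_zero]
        exact h.hasDerivAt_lieAdj_zero
      have := h2.scomp (0 : ℝ) (hasDerivAt_neg (0 : ℝ))
      simpa [Function.comp_def] using this
    have h2 := ContinuousLinearMap.hasDerivAt_comp (F' := (E →L[ℝ] ℝ) →L[ℝ] (E →L[ℝ] ℝ))
      (dualMapCLM E) h1
    simp only [coAdCLM, coadInfCLM, hinv]
    exact h2
  exact hasDerivAt_of_map_add (fun s t => by rw [h.map_add, coAdCLM_mul]) h0 t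

theorem IsOneParam.contDiff_coAdCLM {X : E} {γ : ℝ → G} (h : IsOneParam X γ) :
    ContDiff ℝ ∞ (fun s => (coAdCLM (γ s) : (E →L[ℝ] ℝ) →L[ℝ] (E →L[ℝ] ℝ))) :=
  contDiff_of_hasDerivAt_comp h.hasDerivAt_coAdCLM

variable [T2Space G] {η : E →L[ℝ] ℝ}

theorem hasDerivAt_coAd_lieExp (X : E) (ν : E →L[ℝ] ℝ) (t : ℝ) :
    HasDerivAt (fun s : ℝ => coAd (lieExp G (s • X)) ν)
      (coadInf G X (coAd (lieExp G (t • X)) ν)) t := by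
  have h := ((isOneParam_lieExp (G := G) X).hasDerivAt_coAdCLM t).clm_apply (hasDerivAt_const t ν)
  simp only [map_zero, add_zero, ContinuousLinearMap.comp_apply, coadInfCLM_apply] at h
  exact h

variable {W : Type*} [NormedAddCommGroup W] [NormedSpace ℝ W]

/-- The derivative along a fundamental vector field of the restriction of a linear map to the orbit
is again the restriction of a linear map. -/
theorem orbitDeriv_clm (Y : E) (L : (E →L[ℝ] ℝ) →L[ℝ] W) (ν : CoadjointOrbit G η) :
    orbitDeriv Y (fun μ : CoadjointOrbit G η => L μ.val) ν = L (coadInf G Y ν.val) := by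
  have h := L.hasFDerivAt.comp_hasDerivAt (0 : ℝ) (hasDerivAt_coAd_lieExp (G := G) Y ν.val 0)
  rw [zero_smul, lieExp_zero, coAd_one] at h
  exact h.deriv

theorem exists_orbitIterDeriv_clm (η : E →L[ℝ] ℝ) (l : List E) :
    ∃ A : (E →L[ℝ] ℝ) →L[ℝ] (E →L[ℝ] ℝ), ∀ L : (E →L[ℝ] ℝ) →L[ℝ] W,
      orbitIterDeriv l (fun μ : CoadjointOrbit G η => L μ.val) = fun ν => L (A ν.val) := by
  induction l with
  | nil => exact ⟨ContinuousLinearMap.id ℝ _, fun L => rfl⟩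
  | cons Y l ih =>
    obtain ⟨A, hA⟩ := ih
    refine ⟨A.comp (coadInfCLM G Y), fun L => ?_⟩
    funext ν
    change orbitDeriv Y (orbitIterDeriv l (fun μ : CoadjointOrbit G η => L μ.val)) ν = _
    rw [hA L]
    simpa only [ContinuousLinearMap.comp_apply, coadInfCLM_apply] using
      orbitDeriv_clm Y (L.comp A) ν

end Derivatives

/-! ### The action on the orbit and the `C^∞` topology -/

variable (η : E →L[ℝ] ℝ)

/-- The action of `G` on the orbit by diffeomorphisms. -/
def actHom : G →* OrbitDiffeo G η where
  toFun g := ⟨⟨CoadjointOrbit.act g, CoadjointOrbit.act g⁻¹,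
      fun ν => Subtype.ext (by
        change coAd g⁻¹ (coAd g ν.val) = _
        rw [← coAd_mul, inv_mul_cancel, coAd_one]; rfl),
      fun ν => Subtype.ext (by
        change coAd g (coAd g⁻¹ ν.val) = _
        rw [← coAd_mul, mul_inv_cancel, coAd_one]; rfl)⟩,
    ⟨coAdCLM g, (coAdCLM g).contDiff, fun _ => rfl⟩,
    ⟨coAdCLM g⁻¹, (coAdCLM g⁻¹).contDiff, fun _ => rfl⟩⟩
  map_one' := Subtype.ext (Equiv.ext fun ν => Subtype.ext (coAd_one _))
  map_mul' g h := Subtype.ext (Equiv.ext fun ν => Subtype.ext (coAd_mul g h _))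

variable {η}

theorem actHom_app (g : G) (ν : CoadjointOrbit G η) :
    (actHom η g).app ν = CoadjointOrbit.act g ν := rfl

variable [FiniteDimensional ℝ E] [T2Space G]

variable (η) in
/-- The action `G → Diff(𝒪)` is continuous for the `C^∞` topology. -/
theorem continuous_actHom [CompactSpace G] : Continuous (actHom η : G → OrbitDiffeo G η) := by
  refine continuous_iInf_rng.2 fun l => continuous_induced_rng.2 ?_
  obtain ⟨A, hA⟩ := exists_orbitIterDeriv_clm (G := G) (W := E →L[ℝ] ℝ) η l
  obtain ⟨C, hC⟩ := CoadjointOrbit.exists_norm_val_le (G := G) η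
  have h1 : ∀ g : G, orbitIterDeriv l (fun ν => ((actHom η g).app ν).val) =
      fun ν : CoadjointOrbit G η => coAdCLM g (A ν.val) := fun g => hA (coAdCLM g)
  simp only [Function.comp_def, h1]
  exact continuous_uniformFun_clm_apply (continuous_coAdCLM E G) (C := ‖A‖ * C)
    fun ν => (A.le_opNorm _).trans (by gcongr; exact hC ν)

/-! ### Hamiltonian flows and circle actions -/

theorem smoothFamilyOnOrbit_actHom_lieExp (X : E) (c : ℝ) :
    SmoothFamilyOnOrbit
      (fun (t : ℝ) ν => ((actHom η (lieExp G ((c * t) • X))).app ν).val) := by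
  refine ⟨fun p => coAdCLM (lieExp G ((c * p.1) • X)) p.2, ?_, fun _ _ => rfl⟩
  have h := (isOneParam_lieExp (G := G) X).contDiff_coAdCLM
  exact (h.comp (contDiff_const.mul contDiff_fst)).clm_apply contDiff_snd

/-- `Ad*(exp X)` is the time-one map of the Hamiltonian flow of `ν ↦ ⟨ν, X⟩`. -/
theorem actHom_lieExp_mem_orbitHam (X : E) : actHom η (lieExp G X) ∈ orbitHam G η := by
  refine ⟨fun _ ν => ν.val X, fun t => actHom η (lieExp G (t • X)), ?_, ?_, ?_, ?_, ?_⟩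
  · exact ⟨fun p => p.2 X, contDiff_snd.clm_apply contDiff_const, fun _ _ => rfl⟩
  · simpa only [one_mul] using smoothFamilyOnOrbit_actHom_lieExp (G := G) (η := η) X 1
  · simp only [zero_smul]
    rw [lieExp_zero, map_one]
  · simp
  · intro t ν
    refine ⟨coadInf G X (coAd (lieExp G (t • X)) ν.val), ⟨⟨X, rfl⟩, fun Y => ?_⟩,
      hasDerivAt_coAd_lieExp X ν.val t⟩
    have : CompleteSpace E := FiniteDimensional.complete ℝ E
    have h1 := orbitDeriv_clm (G := G) Y (ContinuousLinearMap.apply ℝ ℝ X)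
      (CoadjointOrbit.act (lieExp G (t • X)) ν)
    have h2 : lieBr G X Y = -lieBr G Y X :=
      (lie_skew (L := GroupLieAlgebra 𝓘(ℝ, E) G) X Y).symm
    refine (kksForm_coadInf _ X Y).trans (Eq.trans ?_ h1.symm)
    rw [ContinuousLinearMap.apply_apply, coadInf_apply, h2, map_neg]
    rfl

/-- If `exp X = 1`, then `t ↦ exp (tX)` has period `1` and descends to the circle. -/
theorem exists_circleHom {X : E} (hX : lieExp G X = 1) :
    ∃ c : Circle →* G, Continuous c ∧
      ∀ t : ℝ, c (Circle.exp (2 * Real.pi * t)) = lieExp G (t • X) := by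
  have hγ := isOneParam_lieExp (G := G) X
  have hper : Function.Periodic (fun t : ℝ => lieExp G (t • X)) 1 := fun t => by
    have := hγ.map_add t 1
    simpa [hX] using this
  have hpi : (2 * Real.pi) ≠ 0 := by positivity
  have hwd : ∀ t : ℝ, lieExp G ((Complex.arg (Circle.exp (2 * Real.pi * t)) / (2 * Real.pi)) • X)
      = lieExp G (t • X) := fun t => by
    obtain ⟨m, hm⟩ := Circle.exp_eq_exp.1 (Circle.exp_arg (Circle.exp (2 * Real.pi * t)))
    have : Complex.arg (Circle.exp (2 * Real.pi * t)) / (2 * Real.pi) = t + m * 1 := by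
      rw [hm]
      field_simp
    rw [this]
    exact hper.int_mul m t
  have hsurj : ∀ z : Circle, ∃ t : ℝ, Circle.exp (2 * Real.pi * t) = z := fun z =>
    ⟨Complex.arg z / (2 * Real.pi), by rw [mul_div_cancel₀ _ hpi, Circle.exp_arg]⟩
  refine ⟨MonoidHom.mk' (fun z => lieExp G ((Complex.arg z / (2 * Real.pi)) • X)) ?_, ?_, hwd⟩
  · intro z w
    obtain ⟨s, rfl⟩ := hsurj z
    obtain ⟨t, rfl⟩ := hsurj w
    rw [← Circle.exp_add, ← mul_add, hwd, hwd, hwd, hγ.map_add]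
  · have hq : Topology.IsQuotientMap Circle.exp :=
      isLocalHomeomorph_circleExp.isOpenMap.isQuotientMap Circle.exp.continuous
        Circle.exp_surjective
    refine hq.continuous_iff.2 ?_
    have hc : Continuous (fun t : ℝ => lieExp G (t • X)) := hγ.isMIntegralCurve.continuous
    refine (hc.comp (continuous_id.div_const (2 * Real.pi))).congr fun t => ?_
    have := hwd (t / (2 * Real.pi))
    rw [mul_div_cancel₀ _ hpi] at this
    exact this.symm

/-- The homomorphism `U(1) → G`, `e^{2πit} ↦ exp (tX)`, for `exp X = 1`. -/
def circleHom (X : E) (hX : lieExp G X = 1) : Circle →* G := (exists_circleHom hX).choose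

theorem continuous_circleHom {X : E} (hX : lieExp G X = 1) : Continuous (circleHom X hX) :=
  (exists_circleHom hX).choose_spec.1

theorem circleHom_exp {X : E} (hX : lieExp G X = 1) (t : ℝ) :
    circleHom X hX (Circle.exp (2 * Real.pi * t)) = lieExp G (t • X) :=
  (exists_circleHom hX).choose_spec.2 t

theorem circleHom_exp_eq {X : E} (hX : lieExp G X = 1) (t : ℝ) :
    circleHom X hX (Circle.exp t) = lieExp G (((2 * Real.pi)⁻¹ * t) • X) := by
  rw [← circleHom_exp hX, mul_inv_cancel_left₀ (by positivity)]

variable (η) in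
/-- The Hamiltonian circle action generated by `X`, for `exp X = 1`. -/
def HamCircleAction.ofLieExpEqOne (X : E) (hX : lieExp G X = 1) : HamCircleAction G η where
  hom := (actHom η).comp (circleHom X hX)
  mem_ham z := by
    obtain ⟨t, rfl⟩ := Circle.exp_surjective z
    rw [MonoidHom.comp_apply, circleHom_exp_eq]
    exact actHom_lieExp_mem_orbitHam _
  smooth := by
    simp only [MonoidHom.comp_apply, circleHom_exp_eq]
    exact smoothFamilyOnOrbit_actHom_lieExp X _

theorem HamCircleAction.isGeneratedBy_ofLieExpEqOne (X : E) (hX : lieExp G X = 1) :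
    (HamCircleAction.ofLieExpEqOne η X hX).IsGeneratedBy X := by
  intro t ν
  change (actHom η (circleHom X hX _)).app ν = _
  rw [circleHom_exp, actHom_app]

theorem circleHom_lieAdj {X : E} (hX : lieExp G X = 1) (g : G)
    (hgX : lieExp G (lieAdj g X : E) = 1) (z : Circle) :
    circleHom (lieAdj g X : E) hgX z = g * circleHom X hX z * g⁻¹ := by
  obtain ⟨t, rfl⟩ := Circle.exp_surjective z
  rw [circleHom_exp_eq, circleHom_exp_eq, lieExp_lieAdj]

/-- For connected `G`, the circle actions generated by `X` and by `Ad g X` are homotopic: move `g`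
along a path to the identity. -/
theorem exists_homotopic_of_lieAdj [CompactSpace G] [ConnectedSpace G] (η : E →L[ℝ] ℝ) {X : E}
    (hX : lieExp G X = 1) (g : G) :
    ∃ ψ ψ' : HamCircleAction G η,
      ψ.IsGeneratedBy X ∧ ψ'.IsGeneratedBy (lieAdj g X) ∧ ψ.Homotopic ψ' := by
  have : LocallyPathConnectedSpace G := ChartedSpace.locallyPathConnectedSpace E G
  have : PathConnectedSpace G := pathConnectedSpace_iff_connectedSpace.2 inferInstance
  have : IsTopologicalGroup G := topologicalGroup_of_lieGroup 𝓘(ℝ, E) ∞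
  have hAd : ∀ a : G, lieExp G (lieAdj a X : E) = 1 := fun a => by
    have := lieExp_lieAdj a X 1
    simpa [hX] using this
  let p : Path (1 : G) g := PathConnectedSpace.somePath 1 g
  let Ψ : unitInterval → HamCircleAction G η := fun s =>
    HamCircleAction.ofLieExpEqOne η (lieAdj (p s) X) (hAd (p s))
  have hgen : ∀ s, (Ψ s).IsGeneratedBy (lieAdj (p s) X : E) := fun s =>
    HamCircleAction.isGeneratedBy_ofLieExpEqOne _ _
  refine ⟨Ψ 0, Ψ 1, ?_, ?_, Ψ, rfl, rfl, ?_⟩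
  · have h := hgen 0
    rw [p.source, lieAdj_one] at h
    exact h
  · have h := hgen 1
    rw [p.target] at h
    exact h
  · have h : ∀ q : unitInterval × Circle,
        (Ψ q.1).hom q.2 = actHom η (p q.1 * circleHom X hX q.2 * (p q.1)⁻¹) := fun q =>
      congrArg (actHom η) (circleHom_lieAdj hX (p q.1) (hAd _) q.2)
    simp only [h]
    have hp : Continuous fun q : unitInterval × Circle => p q.1 := p.continuous.comp continuous_fst
    exact (continuous_actHom η).comp
      ((hp.mul ((continuous_circleHom hX).comp continuous_snd)).mul hp.inv)

end CoadjointAction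

end

theorem theorem1p8
    {E : Type*} [NormedAddCommGroup E] [NormedSpace ℝ E] [FiniteDimensional ℝ E]
    {G : Type*} [TopologicalSpace G] [ChartedSpace E G] [Group G] [LieGroup 𝓘(ℝ, E) ∞ G]
    [T2Space G] [CompactSpace G] [ConnectedSpace G]
    (η : E →L[ℝ] ℝ) (H : Subgroup G) (hmax : IsMaximalTorus H)
    (hstab : ∀ a ∈ H, coAd a η = η)
    (X X' : E) (hX : X ∈ integerLattice H) (hX' : X' ∈ integerLattice H)
    (w : WeylGroup H) (hw : WeylSends w X X') :
    ∃ ψ ψ' : HamCircleAction G η,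
      ψ.IsGeneratedBy X ∧ ψ'.IsGeneratedBy X' ∧ ψ.Homotopic ψ' := by
  obtain ⟨n, -, rfl⟩ := hw
  exact exists_homotopic_of_lieAdj η hX.2 (n : G)
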